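/- Let $P_k$ denote the path with $k$ vertices and $k-1$ edges, and $K_n$ a complete graph on $n$ vertices (vertex sets of different complete graphs may overlap arbitrarily). A $(K_n,\Gamma)$-design, or $\Gamma$-design of order $n$, is a set of subgraphs of $K_n$ (its blocks), each isomorphic to $\Gamma$, whose edge sets partition the edge set of $K_n$. A down-link from a $(K_v,P_k)$-design $\mathcal B$ to a $(K_n,P_4)$-design $\mathcal B'$ is a function $f:\mathcal B\to\mathcal B'$ such that $f(B)$ is a subgraph of $B$ for every $B\in\mathcal B$; if one exists, $\mathcal B$ can be down-linked to $\mathcal B'$. Let $\mathcal L_1P_k(v)$ be the set of all integers $n\ge 0$ such that some $(K_v,P_k)$-design can be down-linked to a $(K_n,P_4)$-design, and let $\mathcal L_2P_k(v)$ be the set of all integers $n\ge 0$ such that every $(K_v,P_k)$-design can be down-linked to a $(K_n,P_4)$-design. Theorem. For every integer $k\ge 12$ and every integer $v>1$ for which a $(K_v,P_k)$-design exists, $$\Big\{\,n\ge v-\Big\lfloor\frac{k-12}{4}\Big\rfloor \;\Big|\; n\equiv 0,1 \pmod 3\Big\}\subseteq \mathcal L_2P_k(v)\subseteq \mathcal L_1P_k(v).$$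 -/

import Mathlib

/-- The complete graph whose vertex set is the finite set `X`. All vertices are taken from the
infinite stock `ℕ`, so that graphs on different vertex sets can be compared, and every graph
is a subgraph (with its own vertex set) of the complete graph on `ℕ`. -/
def completeOn (X : Finset ℕ) : (⊤ : SimpleGraph ℕ).Subgraph :=
  (⊤ : (⊤ : SimpleGraph ℕ).Subgraph).induce (X : Set ℕ)

/-- `𝓑` is a `(K, Γ)`-design: a set of subgraphs of `K`, each isomorphic to `Γ`, whose edge sets
partition the edge set of `K`. -/
structure IsDesign {W : Type*} (K : (⊤ : SimpleGraph ℕ).Subgraph) (Γ : SimpleGraph W)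
    (𝓑 : Set (⊤ : SimpleGraph ℕ).Subgraph) : Prop where
  le : ∀ B ∈ 𝓑, B ≤ K
  iso : ∀ B ∈ 𝓑, Nonempty (B.coe ≃g Γ)
  partition : ∀ e ∈ K.edgeSet, ∃! B, B ∈ 𝓑 ∧ e ∈ B.edgeSet

/-- `f` is a down-link from `𝓑` to `𝓑'`: it maps each block to a subgraph of that block. -/
def IsDownLink {𝓑 𝓑' : Set (⊤ : SimpleGraph ℕ).Subgraph} (f : 𝓑 → 𝓑') : Prop :=
  ∀ B : 𝓑, (f B : (⊤ : SimpleGraph ℕ).Subgraph) ≤ (B : (⊤ : SimpleGraph ℕ).Subgraph)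

/-- `v` is admissible for `Γ`: there exists a `Γ`-design of order `v`. -/
def IsAdmissible {W : Type*} (Γ : SimpleGraph W) (v : ℕ) : Prop :=
  ∃ X : Finset ℕ, X.card = v ∧ ∃ 𝓑, IsDesign (completeOn X) Γ 𝓑

/-- The set of all `n` such that some `Γ`-design of order `v` can be down-linked to a
`Γ'`-design of order `n`. -/
def spectrumSome {W W' : Type*} (Γ : SimpleGraph W) (Γ' : SimpleGraph W') (v : ℕ) : Set ℕ :=
  {n | ∃ X : Finset ℕ, X.card = v ∧ ∃ 𝓑, IsDesign (completeOn X) Γ 𝓑 ∧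
    ∃ Y : Finset ℕ, Y.card = n ∧ ∃ 𝓑', IsDesign (completeOn Y) Γ' 𝓑' ∧
      ∃ f : 𝓑 → 𝓑', IsDownLink f}

/-- The set of all `n` such that every `Γ`-design of order `v` can be down-linked to a
`Γ'`-design of order `n`. -/
def spectrumEvery {W W' : Type*} (Γ : SimpleGraph W) (Γ' : SimpleGraph W') (v : ℕ) : Set ℕ :=
  {n | ∀ X : Finset ℕ, X.card = v → ∀ 𝓑, IsDesign (completeOn X) Γ 𝓑 →
    ∃ Y : Finset ℕ, Y.card = n ∧ ∃ 𝓑', IsDesign (completeOn Y) Γ' 𝓑' ∧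
      ∃ f : 𝓑 → 𝓑', IsDownLink f}

/-- The set `𝓛₁P_k(v)`, for down-links to `P_4`-designs; `SimpleGraph.pathGraph k` is the path
with `k` vertices. -/
def L₁P (k v : ℕ) : Set ℕ :=
  spectrumSome (SimpleGraph.pathGraph k) (SimpleGraph.pathGraph 4) v

/-- The set `𝓛₂P_k(v)`, for down-links to `P_4`-designs. -/
def L₂P (k v : ℕ) : Set ℕ :=
  spectrumEvery (SimpleGraph.pathGraph k) (SimpleGraph.pathGraph 4) v

/-! Choose `Y` with `n` vertices and `X \ Y` as small as possible, and two apexes `x`, `y` in `Y`. A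
block has `k` vertices, hence `|X \ Y| + 3` disjoint runs of four consecutive vertices; the `|X \ Y|
+ 2` vertices of `(X \ Y) ∪ {x, y}` cannot meet all of them. So every block contains a `P_4` inside
`Y \ {x, y}`, and these `P_4`s are edge-disjoint because the blocks are. What they leave of the
complete graph on `Y` is a double cone: `x` and `y` are adjacent to each other and to everything
else.

The core is `isPathUnion_coneEdges`: a double cone on at least four vertices whose number of edges
is divisible by three splits into `P_4`s. Strip `P_4`s from the part `F` away from the apexes until
none is left. Every component of `F` is then a triangle, a star or an isolated vertex, and
triangles, pairs of leaves and triples of isolated vertices can be removed together with their edges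
to `x` and `y`. A few tiny cones end the induction. -/

/-- The edges of the path `a b c d`. -/
def pathEdges (a b c d : ℕ) : Finset (Sym2 ℕ) := {s(a, b), s(b, c), s(c, d)}

/-- `E` is a disjoint union of edge sets of paths with four vertices. -/
inductive IsPathUnion : Finset (Sym2 ℕ) → Prop
  | empty : IsPathUnion ∅
  | union (a b c d : ℕ) (E : Finset (Sym2 ℕ)) (hnd : [a, b, c, d].Nodup)
      (hdisj : Disjoint (pathEdges a b c d) E) (hE : IsPathUnion E) :
      IsPathUnion (pathEdges a b c d ∪ E)

theorem IsPathUnion.add {E E' : Finset (Sym2 ℕ)} (a b c d : ℕ) (hE : IsPathUnion E)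
    (hnd : [a, b, c, d].Nodup) (h₁ : s(a, b) ∉ E) (h₂ : s(b, c) ∉ E) (h₃ : s(c, d) ∉ E)
    (h : E' = pathEdges a b c d ∪ E) : IsPathUnion E' := by
  rw [h]
  exact .union a b c d E hnd (by simp [pathEdges, h₁, h₂, h₃]) hE

theorem card_pathEdges {a b c d : ℕ} (hnd : [a, b, c, d].Nodup) :
    (pathEdges a b c d).card = 3 := by
  simp only [List.nodup_cons, List.mem_cons, List.not_mem_nil, or_false, not_or] at hnd
  rw [pathEdges, Finset.card_eq_three]
  exact ⟨_, _, _, by simp; grind, by simp; grind, by simp; grind, rfl⟩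

/-! ### Double cones: reductions and base cases -/

/-- The edge set of the graph on `W` together with two further vertices `x` and `y`, in which
`x` and `y` are adjacent to every other vertex and the remaining edges are those in `F`. -/
def coneEdges (x y : ℕ) (W : Finset ℕ) (F : Finset (Sym2 ℕ)) : Finset (Sym2 ℕ) :=
  insert s(x, y) (W.image (fun w => s(x, w)) ∪ W.image (fun w => s(y, w)) ∪ F)

section Cone

variable {x y : ℕ} {W : Finset ℕ} {F : Finset (Sym2 ℕ)}

theorem mem_coneEdges {e : Sym2 ℕ} :
    e ∈ coneEdges x y W F ↔
      e = s(x, y) ∨ (∃ w ∈ W, e = s(x, w)) ∨ (∃ w ∈ W, e = s(y, w)) ∨ e ∈ F := by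
  simp [coneEdges, eq_comm]

theorem mem_coneEdges_insert {e : Sym2 ℕ} {l : ℕ} :
    e ∈ coneEdges x y (insert l W) F ↔
      e = s(x, l) ∨ e = s(y, l) ∨ e ∈ coneEdges x y W F := by
  simp only [mem_coneEdges, Finset.exists_mem_insert]
  exact Iff.of_eq (by ac_rfl)

theorem mem_coneEdges_insert_edge {e e' : Sym2 ℕ} :
    e ∈ coneEdges x y W (insert e' F) ↔ e = e' ∨ e ∈ coneEdges x y W F := by
  simp only [mem_coneEdges, Finset.mem_insert]
  exact Iff.of_eq (by ac_rfl)

theorem mem_coneEdges_empty {e : Sym2 ℕ} : e ∈ coneEdges x y ∅ ∅ ↔ e = s(x, y) := by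
  simp [mem_coneEdges]

/-- `F` is a set of edges on the vertex set `W`. -/
def IsEdgesOn (W : Finset ℕ) (F : Finset (Sym2 ℕ)) : Prop :=
  ∀ a b, s(a, b) ∈ F → a ≠ b ∧ a ∈ W ∧ b ∈ W

theorem notMem_coneEdges (hF : IsEdgesOn W F) {l z : ℕ} (hlx : l ≠ x) (hly : l ≠ y)
    (hlW : l ∉ W) : s(l, z) ∉ coneEdges x y W F := by
  rw [mem_coneEdges]
  rintro (h | ⟨w, hw, h⟩ | ⟨w, hw, h⟩ | h)
  · simp at h; grind
  · simp at h; grind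
  · simp at h; grind
  · exact hlW (hF _ _ h).2.1

theorem notMem_coneEdges' (hF : IsEdgesOn W F) {l z : ℕ} (hlx : l ≠ x) (hly : l ≠ y)
    (hlW : l ∉ W) : s(z, l) ∉ coneEdges x y W F := by
  rw [Sym2.eq_swap]; exact notMem_coneEdges hF hlx hly hlW

/-- Two pendant edges with distinct non-adjacent leaves can be removed together with the leaves. -/
theorem isPathUnion_cone_leaves (hF : IsEdgesOn W F) (hxy : x ≠ y) {c c' l l' : ℕ}
    (hx : x ∉ insert l (insert l' W)) (hy : y ∉ insert l (insert l' W)) (hl : l ∉ W) (hl' : l' ∉ W)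
    (hll' : l ≠ l') (hc : c ∈ W) (hc' : c' ∈ W) (h : IsPathUnion (coneEdges x y W F)) :
    IsPathUnion (coneEdges x y (insert l (insert l' W)) (insert s(c, l) (insert s(c', l') F))) := by
  simp only [Finset.mem_insert, not_or] at hx hy
  obtain ⟨hxl, hxl', hxW⟩ := hx
  obtain ⟨hyl, hyl', hyW⟩ := hy
  have n1 := fun z => notMem_coneEdges (z := z) hF (Ne.symm hxl) (Ne.symm hyl) hl
  have n1' := fun z => notMem_coneEdges' (z := z) hF (Ne.symm hxl) (Ne.symm hyl) hl
  have n2 := fun z => notMem_coneEdges (z := z) hF (Ne.symm hxl') (Ne.symm hyl') hl'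
  have n2' := fun z => notMem_coneEdges' (z := z) hF (Ne.symm hxl') (Ne.symm hyl') hl'
  have h1 : IsPathUnion (pathEdges c l x l' ∪ coneEdges x y W F) := by
    refine h.add c l x l' ?_ (n1' _) (n1 _) (n2' _) rfl
    simp; grind
  refine h1.add c' l' y l ?_ ?_ ?_ ?_ ?_
  · simp; grind
  · simp [pathEdges, n2']; grind
  · simp [pathEdges, n2]; grind
  · simp [pathEdges, n1']; grind
  · ext e
    simp only [mem_coneEdges_insert, mem_coneEdges_insert_edge, Finset.mem_union, pathEdges,
      Finset.mem_insert, Finset.mem_singleton, Sym2.eq_swap (a := l) (b := x),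
      Sym2.eq_swap (a := l') (b := y)]
    exact Iff.of_eq (by ac_rfl)

/-- A triangle component can be removed. -/
theorem isPathUnion_cone_triangle (hF : IsEdgesOn W F) (hxy : x ≠ y) {a b c : ℕ}
    (hx : x ∉ insert a (insert b (insert c W))) (hy : y ∉ insert a (insert b (insert c W)))
    (ha : a ∉ W) (hb : b ∉ W) (hc : c ∉ W) (hab : a ≠ b) (hac : a ≠ c) (hbc : b ≠ c)
    (h : IsPathUnion (coneEdges x y W F)) :
    IsPathUnion (coneEdges x y (insert a (insert b (insert c W)))
      (insert s(a, b) (insert s(b, c) (insert s(c, a) F)))) := by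
  simp only [Finset.mem_insert, not_or] at hx hy
  obtain ⟨hxa, hxb, hxc, hxW⟩ := hx
  obtain ⟨hya, hyb, hyc, hyW⟩ := hy
  have na := fun z => notMem_coneEdges (z := z) hF (Ne.symm hxa) (Ne.symm hya) ha
  have na' := fun z => notMem_coneEdges' (z := z) hF (Ne.symm hxa) (Ne.symm hya) ha
  have nb := fun z => notMem_coneEdges (z := z) hF (Ne.symm hxb) (Ne.symm hyb) hb
  have nb' := fun z => notMem_coneEdges' (z := z) hF (Ne.symm hxb) (Ne.symm hyb) hb
  have nc := fun z => notMem_coneEdges (z := z) hF (Ne.symm hxc) (Ne.symm hyc) hc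
  have nc' := fun z => notMem_coneEdges' (z := z) hF (Ne.symm hxc) (Ne.symm hyc) hc
  have h1 : IsPathUnion (pathEdges x a b y ∪ coneEdges x y W F) :=
    h.add x a b y (by simp; grind) (na' _) (na _) (nb _) rfl
  have h2 : IsPathUnion (pathEdges x b c y ∪ (pathEdges x a b y ∪ coneEdges x y W F)) := by
    refine h1.add x b c y (by simp; grind) ?_ ?_ ?_ rfl
    · simp [pathEdges, nb']; grind
    · simp [pathEdges, nb]; grind
    · simp [pathEdges, nc]; grind
  refine h2.add x c a y (by simp; grind) ?_ ?_ ?_ ?_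
  · simp [pathEdges, nc']; grind
  · simp [pathEdges, nc]; grind
  · simp [pathEdges, na]; grind
  · ext e
    simp only [mem_coneEdges_insert, mem_coneEdges_insert_edge, Finset.mem_union, pathEdges,
      Finset.mem_insert, Finset.mem_singleton, Sym2.eq_swap (b := y)]
    exact Iff.of_eq (by ac_rfl)

/-- Three isolated vertices can be removed. -/
theorem isPathUnion_cone_isolated (hF : IsEdgesOn W F) (hxy : x ≠ y) {a b c : ℕ}
    (hx : x ∉ insert a (insert b (insert c W))) (hy : y ∉ insert a (insert b (insert c W)))
    (ha : a ∉ W) (hb : b ∉ W) (hc : c ∉ W) (hab : a ≠ b) (hac : a ≠ c) (hbc : b ≠ c)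
    (h : IsPathUnion (coneEdges x y W F)) :
    IsPathUnion (coneEdges x y (insert a (insert b (insert c W))) F) := by
  simp only [Finset.mem_insert, not_or] at hx hy
  obtain ⟨hxa, hxb, hxc, hxW⟩ := hx
  obtain ⟨hya, hyb, hyc, hyW⟩ := hy
  have na := fun z => notMem_coneEdges (z := z) hF (Ne.symm hxa) (Ne.symm hya) ha
  have nb := fun z => notMem_coneEdges (z := z) hF (Ne.symm hxb) (Ne.symm hyb) hb
  have nb' := fun z => notMem_coneEdges' (z := z) hF (Ne.symm hxb) (Ne.symm hyb) hb
  have nc := fun z => notMem_coneEdges (z := z) hF (Ne.symm hxc) (Ne.symm hyc) hc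
  have nc' := fun z => notMem_coneEdges' (z := z) hF (Ne.symm hxc) (Ne.symm hyc) hc
  have h1 : IsPathUnion (pathEdges a x b y ∪ coneEdges x y W F) :=
    h.add a x b y (by simp; grind) (na _) (nb' _) (nb _) rfl
  refine h1.add a y c x (by simp; grind) ?_ ?_ ?_ ?_
  · simp [pathEdges, na]; grind
  · simp [pathEdges, nc']; grind
  · simp [pathEdges, nc]; grind
  · ext e
    simp only [mem_coneEdges_insert, Finset.mem_union, pathEdges,
      Finset.mem_insert, Finset.mem_singleton, Sym2.eq_swap (b := x), Sym2.eq_swap (b := y)]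
    exact Iff.of_eq (by ac_rfl)

/-- The first of four base cases, with `W` of size 2, 3, 4 and 4. They are needed because the
reductions must keep two vertices in `W`: the cone over a single vertex is a triangle, which has
three edges but is not a `P_4`. -/
theorem isPathUnion_cone_single_edge {a b : ℕ} (h : [x, y, a, b].Nodup) :
    IsPathUnion (coneEdges x y {a, b} {s(a, b)}) := by
  have h1 : IsPathUnion (pathEdges a x y b) :=
    IsPathUnion.empty.add a x y b (by simp at h ⊢; grind) (by simp) (by simp) (by simp)
      (Finset.union_empty _).symm
  simp only [List.nodup_cons, List.mem_cons, List.not_mem_nil, or_false, not_or] at h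
  refine h1.add x b a y (by simp; grind) ?_ ?_ ?_ ?_
  · simp [pathEdges]; grind
  · simp [pathEdges]; grind
  · simp [pathEdges]; grind
  · ext e
    simp only [← insert_empty_eq, mem_coneEdges_insert, mem_coneEdges_insert_edge,
      mem_coneEdges_empty, pathEdges, Finset.mem_insert, Finset.notMem_empty, or_false,
      Finset.mem_union]
    rw [Sym2.eq_swap (a := a) (b := x), Sym2.eq_swap (a := a) (b := y),
      Sym2.eq_swap (a := b) (b := a)]
    exact Iff.of_eq (by ac_rfl)

theorem isPathUnion_cone_cherry {a b c : ℕ} (h : [x, y, a, b, c].Nodup) :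
    IsPathUnion (coneEdges x y {a, b, c} {s(c, a), s(c, b)}) := by
  simp only [List.nodup_cons, List.mem_cons, List.not_mem_nil, or_false, not_or] at h
  have h1 : IsPathUnion (pathEdges a x c y) :=
    IsPathUnion.empty.add a x c y (by simp; grind) (by simp) (by simp) (by simp)
      (Finset.union_empty _).symm
  have h2 : IsPathUnion (pathEdges c a y b ∪ pathEdges a x c y) := by
    refine h1.add c a y b (by simp; grind) ?_ ?_ ?_ rfl
    · simp [pathEdges]; grind
    · simp [pathEdges]; grind
    · simp [pathEdges]; grind
  refine h2.add c b x y (by simp; grind) ?_ ?_ ?_ ?_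
  · simp [pathEdges]; grind
  · simp [pathEdges]; grind
  · simp [pathEdges]; grind
  · ext e
    simp only [← insert_empty_eq, mem_coneEdges_insert, mem_coneEdges_insert_edge,
      mem_coneEdges_empty, pathEdges, Finset.mem_insert, Finset.notMem_empty, or_false,
      Finset.mem_union]
    rw [Sym2.eq_swap (a := a) (b := x), Sym2.eq_swap (a := a) (b := y),
      Sym2.eq_swap (a := c) (b := y), Sym2.eq_swap (a := b) (b := x)]
    exact Iff.of_eq (by ac_rfl)

theorem isPathUnion_cone_four_isolated {a b c d : ℕ} (h : [x, y, a, b, c, d].Nodup) :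
    IsPathUnion (coneEdges x y {a, b, c, d} ∅) := by
  simp only [List.nodup_cons, List.mem_cons, List.not_mem_nil, or_false, not_or] at h
  have h1 : IsPathUnion (pathEdges a x y b) :=
    IsPathUnion.empty.add a x y b (by simp; grind) (by simp) (by simp) (by simp)
      (Finset.union_empty _).symm
  have h2 : IsPathUnion (pathEdges a y c x ∪ pathEdges a x y b) := by
    refine h1.add a y c x (by simp; grind) ?_ ?_ ?_ rfl
    · simp [pathEdges]; grind
    · simp [pathEdges]; grind
    · simp [pathEdges]; grind
  refine h2.add b x d y (by simp; grind) ?_ ?_ ?_ ?_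
  · simp [pathEdges]; grind
  · simp [pathEdges]; grind
  · simp [pathEdges]; grind
  · ext e
    simp only [← insert_empty_eq, mem_coneEdges_insert,
      mem_coneEdges_empty, pathEdges, Finset.mem_insert, Finset.notMem_empty, or_false,
      Finset.mem_union]
    rw [Sym2.eq_swap (a := a) (b := x), Sym2.eq_swap (a := a) (b := y),
      Sym2.eq_swap (a := c) (b := x), Sym2.eq_swap (a := b) (b := x),
      Sym2.eq_swap (a := d) (b := y)]
    exact Iff.of_eq (by ac_rfl)

theorem isPathUnion_cone_triangle_isolated {a b c d : ℕ} (h : [x, y, a, b, c, d].Nodup) :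
    IsPathUnion (coneEdges x y {a, b, c, d} {s(a, b), s(b, c), s(c, a)}) := by
  simp only [List.nodup_cons, List.mem_cons, List.not_mem_nil, or_false, not_or] at h
  have h1 : IsPathUnion (pathEdges d x y a) :=
    IsPathUnion.empty.add d x y a (by simp; grind) (by simp) (by simp) (by simp)
      (Finset.union_empty _).symm
  have h2 : IsPathUnion (pathEdges d y b x ∪ pathEdges d x y a) := by
    refine h1.add d y b x (by simp; grind) ?_ ?_ ?_ rfl
    · simp [pathEdges]; grind
    · simp [pathEdges]; grind
    · simp [pathEdges]; grind
  have h3 : IsPathUnion (pathEdges x c b a ∪ (pathEdges d y b x ∪ pathEdges d x y a)) := by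
    refine h2.add x c b a (by simp; grind) ?_ ?_ ?_ rfl
    · simp [pathEdges]; grind
    · simp [pathEdges]; grind
    · simp [pathEdges]; grind
  refine h3.add x a c y (by simp; grind) ?_ ?_ ?_ ?_
  · simp [pathEdges]; grind
  · simp [pathEdges]; grind
  · simp [pathEdges]; grind
  · ext e
    simp only [← insert_empty_eq, mem_coneEdges_insert, mem_coneEdges_insert_edge,
      mem_coneEdges_empty, pathEdges, Finset.mem_insert, Finset.notMem_empty, or_false,
      Finset.mem_union]
    rw [Sym2.eq_swap (a := d) (b := x), Sym2.eq_swap (a := d) (b := y),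
      Sym2.eq_swap (a := b) (b := x), Sym2.eq_swap (a := c) (b := b),
      Sym2.eq_swap (a := b) (b := a), Sym2.eq_swap (a := c) (b := y),
      Sym2.eq_swap (a := c) (b := a)]
    exact Iff.of_eq (by ac_rfl)

end Cone

/-! ### Decomposition of double cones -/

theorem coneEdges_union {x y : ℕ} {W : Finset ℕ} {F T : Finset (Sym2 ℕ)} (hT : T ⊆ F) :
    coneEdges x y W F = T ∪ coneEdges x y W (F \ T) := by
  ext e
  simp only [mem_coneEdges, Finset.mem_union, Finset.mem_sdiff]
  have := @hT e
  grind

theorem IsEdgesOn.eq_empty {W : Finset ℕ} {F : Finset (Sym2 ℕ)} (h : IsEdgesOn W F)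
    (hW : W.card ≤ 1) : F = ∅ := by
  refine Finset.eq_empty_of_forall_notMem fun e => ?_
  induction e with
  | _ a b =>
    intro he
    obtain ⟨hab, ha, hb⟩ := h a b he
    exact hab (Finset.card_le_one.1 hW a ha b hb)

/-- A graph on at least four vertices with two vertices that are adjacent to all others is a
disjoint union of paths with three edges as soon as its number of edges is divisible by three. -/
theorem isPathUnion_coneEdges {x y : ℕ} (hxy : x ≠ y) (W : Finset ℕ) (F : Finset (Sym2 ℕ))
    (hxW : x ∉ W) (hyW : y ∉ W) (hF : IsEdgesOn W F) (hW : 2 ≤ W.card)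
    (hdvd : 3 ∣ 1 + 2 * W.card + F.card) : IsPathUnion (coneEdges x y W F) := by
  induction hN : W.card + F.card using Nat.strong_induction_on generalizing W F with
  | _ N ih
  have hs : ∀ a b, s(a, b) ∈ F → s(b, a) ∈ F := fun a b h => by rwa [Sym2.eq_swap]
  by_cases hP : ∃ a b c d, [a, b, c, d].Nodup ∧ s(a, b) ∈ F ∧ s(b, c) ∈ F ∧ s(c, d) ∈ F
  · obtain ⟨a, b, c, d, hnd, h1, h2, h3⟩ := hP
    have hsub : pathEdges a b c d ⊆ F := by
      simp [pathEdges, Finset.insert_subset_iff, h1, h2, h3]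
    have hcard := Finset.card_sdiff_add_card_eq_card hsub
    rw [card_pathEdges hnd] at hcard
    rw [coneEdges_union hsub]
    refine .union a b c d _ hnd ?_ (ih _ (by omega) W _ hxW hyW
      (fun p q h => hF p q (Finset.mem_sdiff.1 h).1) hW (by omega) rfl)
    rw [Finset.disjoint_left]
    intro e he hmem
    have heF := hsub he
    rw [mem_coneEdges] at hmem
    rcases hmem with rfl | ⟨w, -, rfl⟩ | ⟨w, -, rfl⟩ | h
    · exact hxW (hF _ _ heF).2.1
    · exact hxW (hF _ _ heF).2.1
    · exact hyW (hF _ _ heF).2.1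
    · exact (Finset.mem_sdiff.1 h).2 he
  -- With no `P_4` in `F`, a walk of three edges that never turns back must close up into a
  -- triangle.
  replace hP : ∀ a b c d, s(a, b) ∈ F → s(b, c) ∈ F → s(c, d) ∈ F → a ≠ c → b ≠ d → a = d := by
    intro a b c d h1 h2 h3 hac hbd
    by_contra had
    refine hP ⟨a, b, c, d, ?_, h1, h2, h3⟩
    have := (hF _ _ h1).1
    have := (hF _ _ h2).1
    have := (hF _ _ h3).1
    simp [*]
  by_cases hT : ∃ a b c, s(a, b) ∈ F ∧ s(b, c) ∈ F ∧ s(c, a) ∈ F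
  · obtain ⟨a, b, c, h1, h2, h3⟩ := hT
    obtain ⟨hab, ha, hb⟩ := hF _ _ h1
    obtain ⟨hbc, -, hc⟩ := hF _ _ h2
    obtain ⟨hca, -, -⟩ := hF _ _ h3
    obtain ⟨W', ha', hb', hc', rfl⟩ : ∃ W', a ∉ W' ∧ b ∉ W' ∧ c ∉ W' ∧
        W = insert a (insert b (insert c W')) :=
      ⟨W \ {a, b, c}, by simp, by simp, by simp, by ext z; simp; grind⟩
    obtain ⟨F', h1', h2', h3', rfl⟩ : ∃ F', s(a, b) ∉ F' ∧ s(b, c) ∉ F' ∧ s(c, a) ∉ F' ∧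
        F = insert s(a, b) (insert s(b, c) (insert s(c, a) F')) :=
      ⟨F \ {s(a, b), s(b, c), s(c, a)}, by simp, by simp, by simp, by ext z; simp; grind⟩
    have hF' : IsEdgesOn W' F' := by
      intro p q hpq
      have hmem : s(p, q) ∈ insert s(a, b) (insert s(b, c) (insert s(c, a) F')) := by simp [hpq]
      have hne1 : s(p, q) ≠ s(a, b) := fun h => h1' (h ▸ hpq)
      have hne2 : s(p, q) ≠ s(b, c) := fun h => h2' (h ▸ hpq)
      have hne3 : s(p, q) ≠ s(c, a) := fun h => h3' (h ▸ hpq)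
      obtain ⟨hne, hp, hq⟩ := hF p q hmem
      simp only [ne_eq, Sym2.eq_iff] at hne1 hne2 hne3
      -- The triangle is a whole component: a further edge at one of its vertices would extend to a
      -- `P_4`.
      have key : ∀ p q, s(p, q) ∈ insert s(a, b) (insert s(b, c) (insert s(c, a) F')) →
          (p = a → q = b ∨ q = c) ∧ (p = b → q = a ∨ q = c) ∧ (p = c → q = a ∨ q = b) := by
        intro p q h
        refine ⟨?_, ?_, ?_⟩ <;> rintro rfl
        · have := hP q p b c (hs _ _ h) h1 h2
          grind
        · have := hP q p c a (hs _ _ h) h2 h3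
          grind
        · have := hP q p a b (hs _ _ h) h3 h1
          grind
      have k1 := key p q hmem
      have k2 := key q p (hs _ _ hmem)
      simp only [Finset.mem_insert] at hp hq
      grind
    have cW : (insert a (insert b (insert c W'))).card = W'.card + 3 := by
      rw [Finset.card_insert_of_notMem (by simp; grind),
        Finset.card_insert_of_notMem (by simp; grind), Finset.card_insert_of_notMem hc']
    have cF : (insert s(a, b) (insert s(b, c) (insert s(c, a) F'))).card = F'.card + 3 := by
      rw [Finset.card_insert_of_notMem (by simp; grind),
        Finset.card_insert_of_notMem (by simp; grind), Finset.card_insert_of_notMem h3']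
    rw [cW, cF] at hdvd hN
    obtain h2W | h2W := le_or_gt 2 W'.card
    · refine isPathUnion_cone_triangle hF' hxy hxW hyW ha' hb' hc' hab hca.symm hbc
        (ih _ (by omega) W' F' ?_ ?_ hF' h2W (by omega) rfl)
      · simp only [Finset.mem_insert, not_or] at hxW; exact hxW.2.2.2
      · simp only [Finset.mem_insert, not_or] at hyW; exact hyW.2.2.2
    -- Divisibility excludes an empty `W'`, so one vertex remains besides the triangle.
    · obtain rfl := hF'.eq_empty (by omega)
      simp only [Finset.card_empty] at hdvd
      obtain ⟨d, rfl⟩ := Finset.card_eq_one.1 (show W'.card = 1 by omega)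
      refine isPathUnion_cone_triangle_isolated ?_
      simp at *
      grind
  replace hT : ∀ a b c, s(a, b) ∈ F → s(b, c) ∈ F → s(c, a) ∉ F :=
    fun a b c h1 h2 h3 => hT ⟨a, b, c, h1, h2, h3⟩
  -- The last alternative ensures that `W` minus the two leaves has at least two vertices, except
  -- possibly when both leaves share their centre; that exception is the cherry.
  have leaves : ∀ c c' l l', s(c, l) ∈ F → s(c', l') ∈ F → l ≠ l' → l ≠ c' → l' ≠ c →
      (∀ z, s(l, z) ∈ F → z = c) → (∀ z, s(l', z) ∈ F → z = c') →
      (c = c' ∨ 4 ≤ W.card) → IsPathUnion (coneEdges x y W F) := by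
    intro c c' l l' h1 h2 hll' hlc' hl'c hl1 hl1' hcard
    obtain ⟨hcl, hc, hl⟩ := hF _ _ h1
    obtain ⟨hcl', hc', hl'⟩ := hF _ _ h2
    obtain ⟨W', hlW, hlW', rfl⟩ : ∃ W', l ∉ W' ∧ l' ∉ W' ∧ W = insert l (insert l' W') :=
      ⟨W \ {l, l'}, by simp, by simp, by ext z; simp; grind⟩
    obtain ⟨F', h1', h2', rfl⟩ : ∃ F', s(c, l) ∉ F' ∧ s(c', l') ∉ F' ∧
        F = insert s(c, l) (insert s(c', l') F') :=
      ⟨F \ {s(c, l), s(c', l')}, by simp, by simp, by ext z; simp; grind⟩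
    have hF' : IsEdgesOn W' F' := by
      intro p q hpq
      have hmem : s(p, q) ∈ insert s(c, l) (insert s(c', l') F') := by simp [hpq]
      have hne1 : s(p, q) ≠ s(c, l) := fun h => h1' (h ▸ hpq)
      have hne2 : s(p, q) ≠ s(c', l') := fun h => h2' (h ▸ hpq)
      obtain ⟨hne, hp, hq⟩ := hF p q hmem
      have hmem' := hs _ _ hmem
      simp only [ne_eq, Sym2.eq_iff] at hne1 hne2
      simp only [Finset.mem_insert] at hp hq
      refine ⟨hne, ?_, ?_⟩
      · rcases hp with rfl | rfl | h
        · have := hl1 q hmem; grind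
        · have := hl1' q hmem; grind
        · exact h
      · rcases hq with rfl | rfl | h
        · have := hl1 p hmem'; grind
        · have := hl1' p hmem'; grind
        · exact h
    have hcW : c ∈ W' := by simp only [Finset.mem_insert] at hc; grind
    have hcW' : c' ∈ W' := by simp only [Finset.mem_insert] at hc'; grind
    have cW : (insert l (insert l' W')).card = W'.card + 2 := by
      rw [Finset.card_insert_of_notMem (by simp; grind), Finset.card_insert_of_notMem hlW']
    have cF : (insert s(c, l) (insert s(c', l') F')).card = F'.card + 2 := by
      rw [Finset.card_insert_of_notMem (by simp; grind), Finset.card_insert_of_notMem h2']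
    rw [cW, cF] at hdvd hN
    rw [cW] at hcard
    obtain h2W | h2W := le_or_gt 2 W'.card
    · refine isPathUnion_cone_leaves hF' hxy hxW hyW hlW hlW' hll' hcW hcW'
        (ih _ (by omega) W' F' ?_ ?_ hF' h2W (by omega) rfl)
      · simp only [Finset.mem_insert, not_or] at hxW; exact hxW.2.2
      · simp only [Finset.mem_insert, not_or] at hyW; exact hyW.2.2
    · obtain rfl := hF'.eq_empty (by omega)
      obtain rfl : c = c' := hcard.resolve_right (by omega)
      have : 0 < W'.card := Finset.card_pos.2 ⟨c, hcW⟩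
      obtain ⟨d, rfl⟩ := Finset.card_eq_one.1 (show W'.card = 1 by omega)
      obtain rfl := Finset.mem_singleton.1 hcW
      refine isPathUnion_cone_cherry ?_
      simp at hxW hyW ⊢
      grind
  by_cases hC : ∃ c l l', l ≠ l' ∧ s(c, l) ∈ F ∧ s(c, l') ∈ F
  · obtain ⟨c, l, l', hll', h1, h2⟩ := hC
    refine leaves c c l l' h1 h2 hll' (hF _ _ h1).1.symm (hF _ _ h2).1.symm ?_ ?_ (.inl rfl)
    -- A second neighbour of `l` would give a `P_4` through `c` to `l'`, or a triangle if it is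
    -- `l'`.
    · intro z hz
      by_contra hzc
      obtain rfl := hP z l c l' (hs _ _ hz) (hs _ _ h1) h2 hzc hll'
      exact hT _ _ _ h1 hz (hs _ _ h2)
    · intro z hz
      by_contra hzc
      obtain rfl := hP z l' c l (hs _ _ hz) (hs _ _ h2) h1 hzc hll'.symm
      exact hT _ _ _ h2 hz (hs _ _ h1)
  -- From here on `F` is a matching.
  replace hC : ∀ c l l', s(c, l) ∈ F → s(c, l') ∈ F → l = l' := fun c l l' h1 h2 => by
    by_contra h
    exact hC ⟨c, l, l', h, h1, h2⟩
  -- Three vertices outside a set `V` carrying all edges of `F` are isolated; `5 ≤ W.card` leaves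
  -- two vertices after their removal.
  have isolated : ∀ V ⊆ W, IsEdgesOn V F → V.card + 3 ≤ W.card → 5 ≤ W.card →
      IsPathUnion (coneEdges x y W F) := by
    intro V hV hFV h3 h5
    have hcard := Finset.card_sdiff_add_card_eq_card hV
    obtain ⟨t, ht, ht3⟩ := Finset.exists_subset_card_eq (show 3 ≤ (W \ V).card by omega)
    obtain ⟨a, b, c, hab, hac, hbc, rfl⟩ := Finset.card_eq_three.1 ht3
    have hsub : ({a, b, c} : Finset ℕ) ⊆ W := ht.trans Finset.sdiff_subset
    have hcard' := Finset.card_sdiff_add_card_eq_card hsub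
    rw [ht3] at hcard'
    have hFW : IsEdgesOn (W \ {a, b, c}) F := by
      intro p q hpq
      obtain ⟨hne, hp, hq⟩ := hFV p q hpq
      refine ⟨hne, ?_, ?_⟩
      · exact Finset.mem_sdiff.2 ⟨hV hp, fun h => (Finset.mem_sdiff.1 (ht h)).2 hp⟩
      · exact Finset.mem_sdiff.2 ⟨hV hq, fun h => (Finset.mem_sdiff.1 (ht h)).2 hq⟩
    have hWeq : W = insert a (insert b (insert c (W \ {a, b, c}))) := by
      ext z
      have := @hsub z
      simp at this ⊢
      grind
    have := isPathUnion_cone_isolated (a := a) (b := b) (c := c) hFW hxy (hWeq ▸ hxW) (hWeq ▸ hyW)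
      (by simp) (by simp) (by simp) hab hac hbc
      (ih _ (by omega) _ F (by simp [hxW]) (by simp [hyW]) hFW (by omega) (by omega) rfl)
    rwa [← hWeq] at this
  obtain h0 | h0 := F.eq_empty_or_nonempty
  · subst h0
    simp only [Finset.card_empty] at hdvd
    -- For empty `F`, divisibility forces `W.card` to be 1 modulo 3, so it is 4 or at least 7.
    obtain h4 | h4 := eq_or_ne W.card 4
    · obtain ⟨a, t, hat, rfl, ht⟩ := Finset.card_eq_succ.1 h4
      obtain ⟨b, c, d, hbc, hbd, hcd, rfl⟩ := Finset.card_eq_three.1 ht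
      refine isPathUnion_cone_four_isolated ?_
      simp at hxW hyW hat ⊢
      grind
    · exact isolated ∅ (by simp) (by simp [IsEdgesOn]) (by simp; omega) (by omega)
  · obtain ⟨e, he⟩ := h0
    induction e with
    | _ a b
    obtain ⟨hab, ha, hb⟩ := hF _ _ he
    by_cases hE : F = {s(a, b)}
    · subst hE
      simp only [Finset.card_singleton] at hdvd
      have hsub : ({a, b} : Finset ℕ) ⊆ W := by simp [Finset.insert_subset_iff, ha, hb]
      -- For a single edge, `W.card` is 2 modulo 3, so it is 2 or at least 5.
      obtain h2 | h2 := eq_or_ne W.card 2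
      · obtain rfl := Finset.eq_of_subset_of_card_le hsub (by rw [h2, Finset.card_pair hab])
        refine isPathUnion_cone_single_edge ?_
        simp at hxW hyW ⊢
        grind
      · refine isolated {a, b} hsub ?_ (by rw [Finset.card_pair hab]; omega) (by omega)
        intro p q hpq
        simp at hpq ⊢
        grind
    · obtain ⟨e', he', hne⟩ : ∃ e' ∈ F, e' ≠ s(a, b) := by
        by_contra! h
        exact hE (Finset.eq_singleton_iff_unique_mem.2 ⟨he, h⟩)
      induction e' with
      | _ c d
      obtain ⟨hcd, hc, hd⟩ := hF _ _ he'
      have hac : a ≠ c := by rintro rfl; exact hne (by rw [hC _ _ _ he he'])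
      have had : a ≠ d := by
        rintro rfl
        exact hne (by rw [hC _ _ _ he (hs _ _ he'), Sym2.eq_swap])
      have hbc : b ≠ c := by
        rintro rfl
        exact hne (by rw [hC _ _ _ (hs _ _ he) he', Sym2.eq_swap])
      have hbd : b ≠ d := by
        rintro rfl
        exact hne (by rw [hC _ _ _ (hs _ _ he) (hs _ _ he')])
      -- Two disjoint edges of the matching: `b` and `d` serve as leaves with centres `a` and `c`.
      refine leaves a c b d he he' hbd hbc had.symm (fun z hz => hC _ _ _ hz (hs _ _ he))
        (fun z hz => hC _ _ _ hz (hs _ _ he')) (.inr ?_)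
      have hsub : ({a, b, c, d} : Finset ℕ) ⊆ W := by
        simp [Finset.insert_subset_iff, ha, hb, hc, hd]
      have : ({a, b, c, d} : Finset ℕ).card = 4 := by
        simp [Finset.card_insert_of_notMem, *]
      exact this ▸ Finset.card_le_card hsub

/-! ### From edge sets to designs -/

/-- The path `a b c d` as a subgraph of the complete graph on `ℕ`. -/
def pathSubgraph (a b c d : ℕ) : (⊤ : SimpleGraph ℕ).Subgraph where
  verts := {a, b, c, d}
  -- The inequality excludes loops, so the definition needs no distinctness of `a b c d`.
  Adj p q := p ≠ q ∧ s(p, q) ∈ pathEdges a b c d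
  adj_sub h := h.1
  edge_vert {p q} h := by
    have := h.2
    simp only [pathEdges, Finset.mem_insert, Finset.mem_singleton, Sym2.eq_iff] at this
    simp only [Set.mem_insert_iff, Set.mem_singleton_iff]
    grind
  symm := ⟨fun p q h => ⟨h.1.symm, Sym2.eq_swap (a := p) ▸ h.2⟩⟩

theorem edgeSet_pathSubgraph {a b c d : ℕ} (hnd : [a, b, c, d].Nodup) :
    (pathSubgraph a b c d).edgeSet = pathEdges a b c d := by
  ext e
  induction e with
  | _ p q =>
  simp only [SimpleGraph.Subgraph.mem_edgeSet, pathSubgraph, Finset.mem_coe, and_iff_right_iff_imp]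
  simp only [List.nodup_cons, List.mem_cons, List.not_mem_nil, or_false, not_or] at hnd
  simp only [pathEdges, Finset.mem_insert, Finset.mem_singleton, Sym2.eq_iff]
  grind

theorem nonempty_iso_pathSubgraph {a b c d : ℕ} (hnd : [a, b, c, d].Nodup) :
    Nonempty ((pathSubgraph a b c d).coe ≃g SimpleGraph.pathGraph 4) := by
  simp only [List.nodup_cons, List.mem_cons, List.not_mem_nil, or_false, not_or] at hnd
  let g : Fin 4 → (pathSubgraph a b c d).verts :=
    ![⟨a, by simp [pathSubgraph]⟩, ⟨b, by simp [pathSubgraph]⟩, ⟨c, by simp [pathSubgraph]⟩,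
      ⟨d, by simp [pathSubgraph]⟩]
  have hg : Function.Bijective g := by
    constructor
    · intro i j hij
      fin_cases i <;> fin_cases j <;> simp [g] at hij ⊢ <;> grind
    · rintro ⟨z, hz⟩
      simp only [pathSubgraph, Set.mem_insert_iff, Set.mem_singleton_iff] at hz
      rcases hz with rfl | rfl | rfl | rfl
      exacts [⟨0, rfl⟩, ⟨1, rfl⟩, ⟨2, rfl⟩, ⟨3, rfl⟩]
  have hadj : ∀ i j, (pathSubgraph a b c d).Adj (g i) (g j) ↔
      (SimpleGraph.pathGraph 4).Adj i j := by
    intro i j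
    rw [SimpleGraph.pathGraph_adj]
    fin_cases i <;> fin_cases j <;> simp [g, pathSubgraph, pathEdges] <;> grind
  exact ⟨RelIso.symm ⟨Equiv.ofBijective g hg, hadj _ _⟩⟩

theorem pathSubgraph_le {a b c d : ℕ} {H : (⊤ : SimpleGraph ℕ).Subgraph} (h₁ : H.Adj a b)
    (h₂ : H.Adj b c) (h₃ : H.Adj c d) : pathSubgraph a b c d ≤ H := by
  refine ⟨?_, ?_⟩
  · rintro z (rfl | rfl | rfl | rfl)
    exacts [h₁.fst_mem, h₁.snd_mem, h₂.snd_mem, h₃.snd_mem]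
  · rintro p q ⟨-, h⟩
    simp only [pathEdges, Finset.mem_insert, Finset.mem_singleton, Sym2.eq_iff] at h
    rcases h with (⟨rfl, rfl⟩ | ⟨rfl, rfl⟩) | (⟨rfl, rfl⟩ | ⟨rfl, rfl⟩) | ⟨rfl, rfl⟩ | ⟨rfl, rfl⟩
    exacts [h₁, h₁.symm, h₂, h₂.symm, h₃, h₃.symm]

theorem completeOn_adj {X : Finset ℕ} {a b : ℕ} :
    (completeOn X).Adj a b ↔ a ∈ X ∧ b ∈ X ∧ a ≠ b := by
  simp [completeOn]

/-- The edges of the complete graph on `X`. -/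
def completeEdges (X : Finset ℕ) : Finset (Sym2 ℕ) := X.offDiag.image Sym2.mk.uncurry

theorem mem_completeEdges {X : Finset ℕ} {a b : ℕ} :
    s(a, b) ∈ completeEdges X ↔ a ∈ X ∧ b ∈ X ∧ a ≠ b := by
  simp [completeEdges]
  grind

theorem card_completeEdges (X : Finset ℕ) : (completeEdges X).card = X.card.choose 2 :=
  Sym2.card_image_offDiag X

theorem edgeSet_completeOn (X : Finset ℕ) : (completeOn X).edgeSet = completeEdges X := by
  ext e
  induction e with
  | _ a b => simp [completeOn_adj, mem_completeEdges]

theorem isEdgesOn_of_subset {X : Finset ℕ} {F : Finset (Sym2 ℕ)} (h : F ⊆ completeEdges X) :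
    IsEdgesOn X F := fun a b hab => by
  obtain ⟨ha, hb, hne⟩ := mem_completeEdges.1 (h hab)
  exact ⟨hne, ha, hb⟩

/-- The members of `𝓟` are paths with four vertices whose edge sets partition `E`. -/
structure IsPathPartition (𝓟 : Set (⊤ : SimpleGraph ℕ).Subgraph) (E : Finset (Sym2 ℕ)) :
    Prop where
  path : ∀ P ∈ 𝓟, ∃ a b c d, [a, b, c, d].Nodup ∧ P = pathSubgraph a b c d ∧ pathEdges a b c d ⊆ E
  partition : ∀ e ∈ E, ∃! P, P ∈ 𝓟 ∧ e ∈ P.edgeSet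

theorem IsPathPartition.edgeSet_subset {𝓟 : Set (⊤ : SimpleGraph ℕ).Subgraph}
    {E : Finset (Sym2 ℕ)} (h : IsPathPartition 𝓟 E) {P : (⊤ : SimpleGraph ℕ).Subgraph}
    (hP : P ∈ 𝓟) : P.edgeSet ⊆ E := by
  obtain ⟨a, b, c, d, hnd, rfl, hE⟩ := h.path P hP
  rw [edgeSet_pathSubgraph hnd]
  exact_mod_cast hE

theorem IsPathPartition.union {𝓟 𝓠 : Set (⊤ : SimpleGraph ℕ).Subgraph}
    {E E' : Finset (Sym2 ℕ)} (h : IsPathPartition 𝓟 E) (h' : IsPathPartition 𝓠 E')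
    (hd : Disjoint E E') : IsPathPartition (𝓟 ∪ 𝓠) (E ∪ E') where
  path := by
    rintro P (hP | hP)
    · obtain ⟨a, b, c, d, hnd, e, hE⟩ := h.path P hP
      exact ⟨a, b, c, d, hnd, e, hE.trans Finset.subset_union_left⟩
    · obtain ⟨a, b, c, d, hnd, e, hE⟩ := h'.path P hP
      exact ⟨a, b, c, d, hnd, e, hE.trans Finset.subset_union_right⟩
  partition := by
    intro e he
    rcases Finset.mem_union.1 he with he | he
    · obtain ⟨P, ⟨hP, heP⟩, huniq⟩ := h.partition e he
      refine ⟨P, ⟨.inl hP, heP⟩, ?_⟩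
      rintro Q ⟨hQ | hQ, heQ⟩
      · exact huniq Q ⟨hQ, heQ⟩
      · exact absurd (h'.edgeSet_subset hQ heQ) (Finset.disjoint_left.1 hd he)
    · obtain ⟨P, ⟨hP, heP⟩, huniq⟩ := h'.partition e he
      refine ⟨P, ⟨.inr hP, heP⟩, ?_⟩
      rintro Q ⟨hQ | hQ, heQ⟩
      · exact absurd he (Finset.disjoint_left.1 hd (h.edgeSet_subset hQ heQ))
      · exact huniq Q ⟨hQ, heQ⟩

theorem IsPathUnion.exists_isPathPartition {E : Finset (Sym2 ℕ)} (h : IsPathUnion E) :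
    ∃ 𝓟, IsPathPartition 𝓟 E := by
  induction h with
  | empty => exact ⟨∅, by simp, by simp⟩
  | union a b c d E hnd hdisj _ ih =>
    obtain ⟨𝓟, h𝓟⟩ := ih
    refine ⟨{pathSubgraph a b c d} ∪ 𝓟, IsPathPartition.union ⟨?_, ?_⟩ h𝓟 hdisj⟩
    · rintro P rfl
      exact ⟨a, b, c, d, hnd, rfl, subset_rfl⟩
    · intro e he
      refine ⟨pathSubgraph a b c d, ⟨rfl, ?_⟩, fun Q hQ => hQ.1⟩
      rw [edgeSet_pathSubgraph hnd]
      exact he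

theorem IsPathPartition.isDesign {𝓟 : Set (⊤ : SimpleGraph ℕ).Subgraph} {X : Finset ℕ}
    (h : IsPathPartition 𝓟 (completeEdges X)) :
    IsDesign (completeOn X) (SimpleGraph.pathGraph 4) 𝓟 where
  le P hP := by
    obtain ⟨a, b, c, d, -, rfl, hE⟩ := h.path P hP
    simp only [pathEdges, Finset.insert_subset_iff, Finset.singleton_subset_iff,
      mem_completeEdges, ← completeOn_adj] at hE
    exact pathSubgraph_le hE.1 hE.2.1 hE.2.2
  iso P hP := by
    obtain ⟨a, b, c, d, hnd, rfl, -⟩ := h.path P hP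
    exact nonempty_iso_pathSubgraph hnd
  partition e he := h.partition e (by rwa [edgeSet_completeOn] at he)

/-! ### Short paths inside blocks and their completion to a design -/

/-- A path with at least `4 * (m + 1)` vertices contains a path with four vertices that avoids
`m` prescribed vertices. -/
theorem exists_path_avoiding {B : (⊤ : SimpleGraph ℕ).Subgraph} {k m : ℕ}
    (hB : Nonempty (B.coe ≃g SimpleGraph.pathGraph k)) (D : Finset ℕ) (hD : D.card ≤ m)
    (hk : 4 * (m + 1) ≤ k) :
    ∃ a b c d, [a, b, c, d].Nodup ∧ B.Adj a b ∧ B.Adj b c ∧ B.Adj c d ∧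
      a ∉ D ∧ b ∉ D ∧ c ∉ D ∧ d ∉ D := by
  obtain ⟨φ⟩ := hB
  let g : Fin k → ℕ := fun i => φ.symm i
  have hg : Function.Injective g := Subtype.val_injective.comp φ.symm.injective
  have hadj : ∀ i j : Fin k, i.val + 1 = j.val → B.Adj (g i) (g j) := fun i j hij =>
    φ.symm.map_rel_iff.2 (SimpleGraph.pathGraph_adj.2 (.inl hij))
  by_contra hcon
  -- The quotient `i / 4` names the run of four consecutive vertices containing `i`. If each of the
  -- `m + 1` runs met `D`, then `D` would have more than `m` elements.
  have hit : ∀ j : Fin (m + 1), ∃ i : Fin k, i.val / 4 = j.val ∧ g i ∈ D := by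
    intro j
    by_contra! hj
    have hjm := j.isLt
    refine hcon ⟨g ⟨4 * j, by omega⟩, g ⟨4 * j + 1, by omega⟩, g ⟨4 * j + 2, by omega⟩,
      g ⟨4 * j + 3, by omega⟩, ?_, hadj _ _ rfl, hadj _ _ rfl, hadj _ _ rfl,
      hj _ ?_, hj _ ?_, hj _ ?_, hj _ ?_⟩
    · simp [hg.eq_iff]
    all_goals simp only; omega
  choose i hi hiD using hit
  have hinj : Function.Injective fun j => g (i j) := fun j j' h => by
    have := hg h
    exact Fin.ext (by rw [← hi j, ← hi j', this])
  have := Finset.card_le_card_of_injOn (s := Finset.univ) (t := D) (fun j => g (i j))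
    (fun j _ => hiD j) hinj.injOn
  simp at this
  omega

/-- Edge-disjoint paths with four vertices that all avoid two given vertices of a complete
graph can be completed to a design if the number of edges is divisible by three. -/
theorem exists_design_of_paths {ι : Type*} [Finite ι] {Y : Finset ℕ} {x y : ℕ} (hx : x ∈ Y)
    (hy : y ∈ Y) (hxy : x ≠ y) (hY : 4 ≤ Y.card) (hdvd : 3 ∣ Y.card.choose 2)
    (a b c d : ι → ℕ) (hnd : ∀ i, [a i, b i, c i, d i].Nodup)
    (hsub : ∀ i, pathEdges (a i) (b i) (c i) (d i) ⊆ completeEdges (Y \ {x, y}))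
    (hdisj : Pairwise fun i j =>
      Disjoint (pathEdges (a i) (b i) (c i) (d i)) (pathEdges (a j) (b j) (c j) (d j))) :
    ∃ 𝓟, IsDesign (completeOn Y) (SimpleGraph.pathGraph 4) 𝓟 ∧
      ∀ i, pathSubgraph (a i) (b i) (c i) (d i) ∈ 𝓟 := by
  have := Fintype.ofFinite ι
  set W := Y \ {x, y} with hW
  set T := Finset.univ.biUnion fun i => pathEdges (a i) (b i) (c i) (d i) with hT
  have hTW : T ⊆ completeEdges W := Finset.biUnion_subset.2 fun i _ => hsub i
  have hTcard : 3 ∣ T.card := by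
    rw [hT, Finset.card_biUnion fun i _ j _ hij => hdisj hij]
    exact Finset.dvd_sum fun i _ => by rw [card_pathEdges (hnd i)]
  have hTpart : IsPathPartition
      (Set.range fun i => pathSubgraph (a i) (b i) (c i) (d i)) T := by
    refine ⟨?_, ?_⟩
    · rintro _ ⟨i, rfl⟩
      exact ⟨_, _, _, _, hnd i, rfl, Finset.subset_biUnion_of_mem
        (fun i => pathEdges (a i) (b i) (c i) (d i)) (Finset.mem_univ i)⟩
    · intro e he
      obtain ⟨i, -, hi⟩ := Finset.mem_biUnion.1 he
      refine ⟨_, ⟨⟨i, rfl⟩, by rw [edgeSet_pathSubgraph (hnd i)]; exact hi⟩, ?_⟩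
      rintro _ ⟨⟨j, rfl⟩, hj⟩
      simp only [edgeSet_pathSubgraph (hnd j), Finset.mem_coe] at hj
      by_contra hne
      have hij : i ≠ j := fun h => hne (h ▸ rfl)
      exact Finset.disjoint_left.1 (hdisj hij) hi hj
  have hxW : x ∉ W := by simp [hW]
  have hyW : y ∉ W := by simp [hW]
  have hpair : ({x, y} : Finset ℕ) ⊆ Y := by simp [Finset.insert_subset_iff, hx, hy]
  have hWcard : W.card + 2 = Y.card := by
    rw [← Finset.card_sdiff_add_card_eq_card hpair, Finset.card_pair hxy]
  have hFcard := Finset.card_sdiff_add_card_eq_card hTW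
  have hF : IsEdgesOn W (completeEdges W \ T) := isEdgesOn_of_subset Finset.sdiff_subset
  rw [card_completeEdges] at hFcard
  -- Edges on `Y` counted by their endpoints among `x` and `y`; this turns `hdvd` into divisibility
  -- for the cone, as `T.card` is a multiple of three.
  have hchoose : (W.card + 2).choose 2 = 1 + 2 * W.card + W.card.choose 2 := by
    simp [Nat.choose_succ_succ']
    omega
  rw [hWcard] at hchoose
  obtain ⟨𝓠, h𝓠⟩ := (isPathUnion_coneEdges hxy W (completeEdges W \ T) hxW hyW hF (by omega)
    (by omega)).exists_isPathPartition
  have hcone : T ∪ coneEdges x y W (completeEdges W \ T) = completeEdges Y := by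
    -- The complete graph on `Y` is itself the double cone over the complete graph on `W`.
    rw [← coneEdges_union hTW]
    ext e
    induction e with
    | _ p q =>
    simp only [mem_coneEdges, mem_completeEdges, Sym2.eq_iff, hW, Finset.mem_sdiff,
      Finset.mem_insert, Finset.mem_singleton]
    constructor
    · rintro (h | ⟨w, hw, h⟩ | ⟨w, hw, h⟩ | h) <;> grind
    · rintro ⟨hp, hq, hpq⟩
      by_cases hpx : p = x
      · by_cases hqy : q = y
        · exact .inl (.inl ⟨hpx, hqy⟩)
        · exact .inr (.inl ⟨q, by grind, .inl ⟨hpx, rfl⟩⟩)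
      by_cases hpy : p = y
      · by_cases hqx : q = x
        · exact .inl (.inr ⟨hpy, hqx⟩)
        · exact .inr (.inr (.inl ⟨q, by grind, .inl ⟨hpy, rfl⟩⟩))
      by_cases hqx : q = x
      · exact .inr (.inl ⟨p, by grind, .inr ⟨rfl, hqx⟩⟩)
      by_cases hqy : q = y
      · exact .inr (.inr (.inl ⟨p, by grind, .inr ⟨rfl, hqy⟩⟩))
      grind
  refine ⟨_, (hcone ▸ hTpart.union h𝓠 ?_).isDesign, fun i => .inl ⟨i, rfl⟩⟩
  rw [Finset.disjoint_left]
  intro e heT hmem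
  have heW := hTW heT
  rw [mem_coneEdges] at hmem
  rcases hmem with rfl | ⟨w, -, rfl⟩ | ⟨w, -, rfl⟩ | h
  · exact hxW (mem_completeEdges.1 heW).1
  · exact hxW (mem_completeEdges.1 heW).1
  · exact hyW (mem_completeEdges.1 heW).1
  · exact (Finset.mem_sdiff.1 h).2 heT

/-! ### Construction of the down-link and the numerical bounds -/

theorem IsDesign.eq_of_mem {W : Type*} {K : (⊤ : SimpleGraph ℕ).Subgraph} {Γ : SimpleGraph W}
    {𝓑 : Set (⊤ : SimpleGraph ℕ).Subgraph} (h : IsDesign K Γ 𝓑)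
    {B C : (⊤ : SimpleGraph ℕ).Subgraph} (hB : B ∈ 𝓑) (hC : C ∈ 𝓑) {e : Sym2 ℕ}
    (heB : e ∈ B.edgeSet) (heC : e ∈ C.edgeSet) : B = C :=
  (h.partition e (SimpleGraph.Subgraph.edgeSet_mono (h.le B hB) heB)).unique ⟨hB, heB⟩ ⟨hC, heC⟩

/-- A design of paths with `k` vertices on `X` can be down-linked to a design of paths with four
vertices on `Y` if `4 * (|X \ Y| + 3) ≤ k`. -/
theorem exists_isDownLink {k : ℕ} {X Y : Finset ℕ} {𝓑 : Set (⊤ : SimpleGraph ℕ).Subgraph}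
    (h𝓑 : IsDesign (completeOn X) (SimpleGraph.pathGraph k) 𝓑) (hk : 4 * ((X \ Y).card + 3) ≤ k)
    (hY : 4 ≤ Y.card) (hdvd : 3 ∣ Y.card.choose 2) :
    ∃ 𝓑', IsDesign (completeOn Y) (SimpleGraph.pathGraph 4) 𝓑' ∧
      ∃ f : 𝓑 → 𝓑', IsDownLink f := by
  obtain ⟨x, hx, y, hy, hxy⟩ := Finset.one_lt_card.1 (show 1 < Y.card by omega)
  have hD : (X \ Y ∪ {x, y}).card ≤ (X \ Y).card + 2 :=
    (Finset.card_union_le _ _).trans (by rw [Finset.card_pair hxy])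
  have hex := fun B : 𝓑 => exists_path_avoiding (h𝓑.iso B B.2) (X \ Y ∪ {x, y}) hD (by omega)
  choose a b c d hnd hab hbc hcd ha hb hc hd using hex
  have hmem : ∀ (B : 𝓑) (e : Sym2 ℕ),
      e ∈ pathEdges (a B) (b B) (c B) (d B) → e ∈ B.1.edgeSet := by
    intro B e he
    simp only [pathEdges, Finset.mem_insert, Finset.mem_singleton] at he
    rcases he with rfl | rfl | rfl
    exacts [hab B, hbc B, hcd B]
  -- The edge `s(a B, b B)` determines its block, and there are finitely many edges on `X`.
  have hfin : Finite 𝓑 := by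
    refine Finite.of_injective (β := completeEdges X) (fun B => ⟨s(a B, b B), ?_⟩) ?_
    · rw [mem_completeEdges, ← completeOn_adj]
      exact (h𝓑.le B B.2).2 (hab B)
    · intro B C hBC
      have hBC' : s(a B, b B) = s(a C, b C) := congrArg Subtype.val hBC
      exact Subtype.ext (h𝓑.eq_of_mem B.2 C.2 (e := s(a B, b B)) (hab B) (hBC' ▸ hab C))
  have hY' : ∀ (B : 𝓑) (z : ℕ), z ∈ B.1.verts → z ∉ X \ Y ∪ {x, y} → z ∈ Y \ {x, y} := by
    intro B z hz hzD
    have hzX : z ∈ X := by simpa [completeOn] using (h𝓑.le B B.2).1 hz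
    simp only [Finset.mem_union, Finset.mem_sdiff, not_or] at hzD ⊢
    exact ⟨by tauto, hzD.2⟩
  obtain ⟨𝓑', h𝓑', hf⟩ := exists_design_of_paths hx hy hxy hY hdvd a b c d hnd
    (fun B => by
      have h1 := hY' B _ (hab B).fst_mem (ha B)
      have h2 := hY' B _ (hab B).snd_mem (hb B)
      have h3 := hY' B _ (hcd B).fst_mem (hc B)
      have h4 := hY' B _ (hcd B).snd_mem (hd B)
      simp only [pathEdges, Finset.insert_subset_iff, Finset.singleton_subset_iff,
        mem_completeEdges]
      exact ⟨⟨h1, h2, (hab B).ne⟩, ⟨h2, h3, (hbc B).ne⟩, ⟨h3, h4, (hcd B).ne⟩⟩)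
    (fun B C hBC => Finset.disjoint_left.2 fun e heB heC =>
      hBC (Subtype.ext (h𝓑.eq_of_mem B.2 C.2 (hmem B e heB) (hmem C e heC))))
  exact ⟨𝓑', h𝓑', fun B => ⟨_, hf B⟩, fun B => pathSubgraph_le (hab B) (hbc B) (hcd B)⟩

/-- Some edge exists, hence some block, and its `k` vertices lie in `X`. This is what makes `n`
large enough for the cone decomposition. -/
theorem IsDesign.le_card {k : ℕ} {X : Finset ℕ} {𝓑 : Set (⊤ : SimpleGraph ℕ).Subgraph}
    (h : IsDesign (completeOn X) (SimpleGraph.pathGraph k) 𝓑) (hX : 1 < X.card) : k ≤ X.card := by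
  obtain ⟨x, hx, y, hy, hxy⟩ := Finset.one_lt_card.1 hX
  obtain ⟨B, ⟨hB, -⟩, -⟩ := h.partition s(x, y) (completeOn_adj.2 ⟨hx, hy, hxy⟩)
  obtain ⟨φ⟩ := h.iso B hB
  have := Finset.card_le_card_of_injOn (s := Finset.univ) (t := X)
    (fun i : Fin k => (φ.symm i : ℕ))
    (fun i _ => by simpa [completeOn] using (h.le B hB).1 (φ.symm i).2)
    (Subtype.val_injective.comp φ.symm.injective).injOn
  simpa using this

theorem exists_card_eq_card_sdiff_eq (X : Finset ℕ) (n : ℕ) :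
    ∃ Y : Finset ℕ, Y.card = n ∧ (X \ Y).card = X.card - n := by
  obtain h | h := le_total n X.card
  · obtain ⟨Y, hY, rfl⟩ := Finset.exists_subset_card_eq h
    exact ⟨Y, rfl, Finset.card_sdiff_of_subset hY⟩
  · obtain ⟨Y, hY, rfl⟩ := Infinite.exists_superset_card_eq X n h
    exact ⟨Y, rfl, by rw [Finset.sdiff_eq_empty_iff_subset.2 hY, Finset.card_empty]; omega⟩

theorem three_dvd_choose_two {n : ℕ} (h : n ≡ 0 [MOD 3] ∨ n ≡ 1 [MOD 3]) : 3 ∣ n.choose 2 := by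
  have h3 : 3 ∣ n * (n - 1) := by
    rcases h with h | h
    · exact ((Nat.modEq_zero_iff_dvd).1 h).mul_right _
    · refine Dvd.dvd.mul_left ?_ _
      unfold Nat.ModEq at h
      omega
  rw [Nat.choose_two_right]
  have := Nat.div_mul_cancel (Nat.even_mul_pred_self n).two_dvd
  omega

theorem theorem4p2 (k v : ℕ) (hk : 12 ≤ k) (hv : 1 < v)
    (hadm : IsAdmissible (SimpleGraph.pathGraph k) v) :
    {n : ℕ | (v : ℤ) - ⌊((k : ℚ) - 12) / 4⌋ ≤ (n : ℤ) ∧ (n ≡ 0 [MOD 3] ∨ n ≡ 1 [MOD 3])} ⊆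
        L₂P k v ∧
      L₂P k v ⊆ L₁P k v := by
  refine ⟨?_, ?_⟩
  · rintro n ⟨hn, hmod⟩ X rfl 𝓑 h𝓑
    have hfloor : 4 * ⌊((k : ℚ) - 12) / 4⌋ ≤ (k : ℤ) - 12 := by
      have := Int.floor_le (((k : ℚ) - 12) / 4)
      have h : 4 * (⌊((k : ℚ) - 12) / 4⌋ : ℚ) ≤ (k : ℚ) - 12 := by linarith
      exact_mod_cast h
    have hkX := h𝓑.le_card hv
    obtain ⟨Y, rfl, hXY⟩ := exists_card_eq_card_sdiff_eq X n
    -- The truncated difference `v - n` is at most `⌊(k - 12) / 4⌋`, which is nonnegative as `12 ≤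
    -- k`. Also `n ≥ k - (k - 12) / 4 ≥ 12`, since `v ≥ k`.
    exact ⟨Y, rfl, exists_isDownLink h𝓑 (by omega) (by omega) (three_dvd_choose_two hmod)⟩
  -- Admissibility is essential here: without any design, the "every" condition would hold
  -- vacuously.
  · intro n hn
    obtain ⟨X, hX, 𝓑, h𝓑⟩ := hadm
    exact ⟨X, hX, 𝓑, h𝓑, hn X hX 𝓑 h𝓑⟩
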